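/- For a finite partially ordered set $X$ let $w(X)$ denote its width, the maximum size of an antichain in $X$. A chain $c$ in $X$ is skipless if, whenever $y$ covers $x$ in $c$, $y$ covers $x$ in $X$. An SD-partition of $X$ is a partition of $X$ into exactly $w(X)$ skipless chains. Let $\mathcal D$ be a downset in the Boolean lattice $\mathcal B(n)$ of subsets of $[n]$ (a family of sets closed under taking subsets), and let $\mathbf C$ be an SD-partition of $\mathcal D$. Let $Y\in\mathcal B(n)\setminus\mathcal D$ with $|Y|=k$ be such that $\mathcal D'=\mathcal D\cup\{Y\}$ is also a downset. Let $\mathcal G_k$ be the bipartite graph whose parts are the $(k-1)$-sets in $\mathcal D'$ and the $k$-sets in $\mathcal D'$, in which a $(k-1)$-set is adjacent to a $k$-set if it is contained in it. Let $\mathbf M$ be the matching in $\mathcal G_k$ consisting of the edges whose two ends lie in the same chain of $\mathbf C$. A path $Y, X_1, Y_1, X_2, Y_2, \ldots, X_r, Y_r, X_{r+1}$ in $\mathcal G_k$ (with distinct vertices, $r\ge 0$) is called augmenting if $\{X_i,Y_i\}\in\mathbf M$ for $i=1,\ldots,r$ and $X_{r+1}$ is the maximum element of its chain in $\mathbf C$.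 Then $w(\mathcal D)=w(\mathcal D')$ if and only if there is an augmenting path in $\mathcal G_k$. -/

import Mathlib

/-- The width of a finite subset `X` of a partially ordered set: the maximum size of an antichain
contained in `X`. -/
noncomputable def width {α : Type*} [PartialOrder α] (X : Finset α) : ℕ := by
  classical
  exact (X.powerset.filter fun A : Finset α => IsAntichain (· ≤ ·) (A : Set α)).sup Finset.card

/-- `y` covers `x` in the subposet `S`. -/
def CoversIn {α : Type*} [PartialOrder α] (S : Finset α) (x y : α) : Prop :=
  x ∈ S ∧ y ∈ S ∧ x < y ∧ ∀ z ∈ S, x ≤ z → z ≤ y → z = x ∨ z = y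

/-- A skipless chain `c` of `X`: a chain contained in `X` in which every covering pair of `c` is a
covering pair of `X`. -/
def IsSkiplessChain {α : Type*} [PartialOrder α] (X c : Finset α) : Prop :=
  c ⊆ X ∧ IsChain (· ≤ ·) (c : Set α) ∧ ∀ x y, CoversIn c x y → CoversIn X x y

/-- An SD-partition of `X`: a partition of `X` into exactly `width X` (nonempty) skipless chains. -/
def IsSDPartition {α : Type*} [PartialOrder α] [DecidableEq α] {X : Finset α}
    (C : Finpartition X) : Prop :=
  (∀ c ∈ C.parts, IsSkiplessChain X c) ∧ C.parts.card = width X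

/-- The bipartite graph induced by a family `F` on levels `k - 1` and `k`: a `(k - 1)`-set and a
`k`-set of `F` are adjacent when the first is contained in the second. (It has no edges if
`k = 0`; sets outside the two parts are isolated.) -/
def levelGraph {n : ℕ} (F : Finset (Finset (Fin n))) (k : ℕ) : SimpleGraph (Finset (Fin n)) where
  Adj A B := A ∈ F ∧ B ∈ F ∧
    ((A.card + 1 = k ∧ B.card = k ∧ A ⊂ B) ∨ (B.card + 1 = k ∧ A.card = k ∧ B ⊂ A))
  symm := ⟨fun _ _ h => ⟨h.2.1, h.1, h.2.2.symm⟩⟩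
  loopless := ⟨fun A h => by
    rcases h.2.2 with h | h
    · exact (ssubset_irrefl A) h.2.2
    · exact (ssubset_irrefl A) h.2.2⟩

/-- The matching formed by the edges of `G` whose two ends belong to the same chain of `C`. -/
def chainMatching {α : Type*} [DecidableEq α] {X : Finset α} (C : Finpartition X)
    (G : SimpleGraph α) : SimpleGraph α where
  Adj a b := G.Adj a b ∧ ∃ c ∈ C.parts, a ∈ c ∧ b ∈ c
  symm := ⟨fun _ _ h => ⟨h.1.symm, h.2.imp fun _ hc => ⟨hc.1, hc.2.2, hc.2.1⟩⟩⟩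
  loopless := ⟨fun _ h => h.1.ne rfl⟩

/-- A walk `Y = v₀, v₁, …, v_m = Z` in `G` is an augmenting path (with respect to the chain
partition `C`) if its vertices are distinct, `m = 2 r + 1` is odd, each edge `v_{2i+1} v_{2i+2}`
belongs to the matching given by `C`, and `Z` is the maximum of its chain in `C`. -/
def IsAugmentingPath {α : Type*} [PartialOrder α] [DecidableEq α] {X : Finset α}
    (C : Finpartition X) {G : SimpleGraph α} {Y Z : α} (p : G.Walk Y Z) : Prop :=
  p.IsPath ∧ Odd p.length ∧
    (∀ i : ℕ, 2 * i + 2 ≤ p.length →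
      (chainMatching C G).Adj (p.getVert (2 * i + 1)) (p.getVert (2 * i + 2))) ∧
    ∃ c ∈ C.parts, IsGreatest (c : Set α) Z

/-!
Along an augmenting path `Y, X₁, Y₁, …, Yᵣ, Xᵣ₊₁` the upper parts of the chains can be shifted:
the part of the chain of `Yᵢ` from `Yᵢ` upwards is moved onto the chain of `Xᵢ₊₁`, starting with
`Y₀ = Y`. This partitions `D ∪ {Y}` into `w(D)` chains.

If there is no augmenting path, every `(k - 1)`-set reached from `Y` by an alternating path is
matched, and its partner differs from `Y`. The family `B` of `Y` and these partners thus has its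
shadow matched into `B \ {Y}`. By Hall's theorem such a matching descends, one level at a time, to
matchings between all consecutive levels of the complex generated by `B`: each of its faces of size
below `k - 1` has a neighbour in its link, and links shrink as faces grow. The matchings combine to
chains that carry each proper subset of a member of `B` up to a member of `B` other than `Y`. A
maximum antichain of `D` with a set below `Y` becomes larger when its sets below `B` are replaced by
the members of `B` above it; one without such a set becomes larger by adding `Y`.
-/

section ChainColoring

variable {α ι : Type*} [Preorder α]

/-- A colouring of `X` whose colour classes are chains, that is, a partition of `X` into chains
indexed by the colours. -/
def IsChainColoring (X : Set α) (col : α → ι) : Prop :=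
  ∀ a ∈ X, ∀ b ∈ X, col a = col b → a ≤ b ∨ b ≤ a

lemma IsChainColoring.mono {X X' : Set α} {col : α → ι} (h : IsChainColoring X col)
    (hX' : X' ⊆ X) : IsChainColoring X' col :=
  fun a ha b hb => h a (hX' ha) b (hX' hb)

lemma IsChainColoring.injOn_of_isAntichain {X T : Set α} {col : α → ι} (h : IsChainColoring X col)
    (hTX : T ⊆ X) (hT : IsAntichain (· ≤ ·) T) : Set.InjOn col T := fun a ha b hb hab =>
  (h a (hTX ha) b (hTX hb) hab).elim (hT.eq ha hb) (hT.eq' ha hb)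

lemma IsChainColoring.piecewise {X H : Set α} [∀ a, Decidable (a ∈ H)] {f g : α → ι}
    (hf : IsChainColoring (X ∩ H) f) (hg : IsChainColoring (X \ H) g)
    (hgf : ∀ a ∈ X ∩ H, ∀ b ∈ X \ H, g b = f a → b ≤ a) :
    IsChainColoring X (H.piecewise f g) := by
  intro a ha b hb hab
  by_cases haH : a ∈ H <;> by_cases hbH : b ∈ H <;>
    simp only [haH, hbH, not_false_eq_true, Set.piecewise_eq_of_mem,
      Set.piecewise_eq_of_notMem] at hab
  · exact hf a ⟨ha, haH⟩ b ⟨hb, hbH⟩ hab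
  · exact .inr (hgf a ⟨ha, haH⟩ b ⟨hb, hbH⟩ hab.symm)
  · exact .inl (hgf b ⟨hb, hbH⟩ a ⟨ha, haH⟩ hab)
  · exact hg a ⟨ha, haH⟩ b ⟨hb, hbH⟩ hab

/-- The partition `C` assigns the junk part `∅` to a point outside `X`, so such a point gets a
colour of its own. -/
lemma isChainColoring_insert_part [DecidableEq α] {X : Finset α} {C : Finpartition X}
    (hC : ∀ c ∈ C.parts, IsChain (· ≤ ·) (c : Set α)) (y : α) :
    IsChainColoring (insert y X : Set α) C.part := by
  intro a ha b hb hab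
  by_cases haX : a ∈ X
  · have hbX : b ∈ X := by
      rw [← C.part_mem, ← hab, C.part_mem]
      exact haX
    exact (hC _ (C.part_mem.2 haX)).total (C.mem_part haX) (hab ▸ C.mem_part hbX)
  · have hbX : b ∉ X := by
      rw [← C.part_eq_empty, ← hab, C.part_eq_empty]
      exact haX
    rw [ha.resolve_right haX, hb.resolve_right hbX]
    exact .inl le_rfl

lemma IsChainColoring.subset_of_card_le {β : Type*} {X : Set (Finset β)} {col : Finset β → ι}
    (h : IsChainColoring X col) {a b : Finset β} (ha : a ∈ X) (hb : b ∈ X) (hab : col a = col b)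
    (hcard : a.card ≤ b.card) : a ⊆ b :=
  (h a ha b hb hab).elim id fun hba => (Finset.eq_of_subset_of_card_le hba hcard).ge

end ChainColoring

section Width

variable {α : Type*} [PartialOrder α]

lemma card_le_width {X T : Finset α} (hTX : T ⊆ X) (hT : IsAntichain (· ≤ ·) (T : Set α)) :
    T.card ≤ width X := by
  classical
  rw [width]
  exact Finset.le_sup (f := Finset.card) (Finset.mem_filter.2 ⟨Finset.mem_powerset.2 hTX, hT⟩)

lemma exists_isAntichain_card_eq_width (X : Finset α) :
    ∃ T ⊆ X, IsAntichain (· ≤ ·) (T : Set α) ∧ T.card = width X := by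
  classical
  obtain ⟨T, hT, hcard⟩ := Finset.exists_mem_eq_sup
    (X.powerset.filter fun A : Finset α => IsAntichain (· ≤ ·) (A : Set α))
    ⟨∅, by simp⟩ Finset.card
  rw [Finset.mem_filter, Finset.mem_powerset] at hT
  exact ⟨T, hT.1, hT.2, by rw [← hcard, width]⟩

lemma width_mono {X X' : Finset α} (h : X ⊆ X') : width X ≤ width X' := by
  obtain ⟨T, hTX, hT, hcard⟩ := exists_isAntichain_card_eq_width X
  exact hcard ▸ card_le_width (hTX.trans h) hT

lemma IsChainColoring.width_le {ι : Type*} {X : Finset α} {col : α → ι}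
    (h : IsChainColoring (X : Set α) col) {I : Finset ι} (hI : Set.MapsTo col X I) :
    width X ≤ I.card := by
  obtain ⟨T, hTX, hT, hcard⟩ := exists_isAntichain_card_eq_width X
  rw [← hcard]
  exact Finset.card_le_card_of_injOn col (hI.mono_left hTX) (h.injOn_of_isAntichain hTX hT)

end Width

section LevelMatching

open Finset
open scoped FinsetFamily

lemma card_le_card_of_injOn_sigma {β γ δ ε : Type*} {U : Finset β} {N : Finset γ}
    {L : β → Finset δ} {L' : γ → Finset ε} (hL : ∀ s ∈ U, (L s).Nonempty)
    (g : (Σ _ : β, δ) → Σ _ : γ, ε) (hg : Set.MapsTo g (U.sigma L) (N.sigma L'))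
    (hinj : Set.InjOn g (U.sigma L)) (hle : ∀ p ∈ U.sigma L, #(L' (g p).1) ≤ #(L p.1)) :
    #U ≤ #N := by
  classical
  have h : (#U : ℚ) ≤ #N :=
    calc (#U : ℚ) = ∑ s ∈ U, ∑ _y ∈ L s, (#(L s) : ℚ)⁻¹ := by
          rw [card_eq_sum_ones, Nat.cast_sum]
          refine sum_congr rfl fun s hs => ?_
          have : (#(L s) : ℚ) ≠ 0 := by exact_mod_cast (hL s hs).card_ne_zero
          simp [this]
      _ = ∑ p ∈ U.sigma L, (#(L p.1) : ℚ)⁻¹ := (sum_sigma U L fun p => (#(L p.1) : ℚ)⁻¹).symm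
      _ ≤ ∑ p ∈ U.sigma L, (#(L' (g p).1) : ℚ)⁻¹ := by
          refine sum_le_sum fun p hp => ?_
          have hpos : 0 < #(L' (g p).1) := card_pos.2 ⟨_, (mem_sigma.1 (hg hp)).2⟩
          have := hle p hp
          gcongr
      _ = ∑ q ∈ (U.sigma L).image g, (#(L' q.1) : ℚ)⁻¹ :=
          (sum_image (f := fun q => (#(L' q.1) : ℚ)⁻¹) hinj).symm
      _ ≤ ∑ q ∈ N.sigma L', (#(L' q.1) : ℚ)⁻¹ :=
          sum_le_sum_of_subset_of_nonneg (image_subset_iff.2 hg) fun _ _ _ => by positivity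
      _ = ∑ t ∈ N, ∑ _y ∈ L' t, (#(L' t) : ℚ)⁻¹ := sum_sigma N L' fun q => (#(L' q.1) : ℚ)⁻¹
      _ ≤ #N := by
          rw [card_eq_sum_ones, Nat.cast_sum]
          refine sum_le_sum fun t _ => ?_
          simpa using mul_inv_le_one
  exact_mod_cast h

variable {α : Type*} {P : Finset (Finset α)} {j m : ℕ} {s : Finset α}

/-- A matching of the sets of size `j` of `P` into those of size `j + 1` that saturates the former,
given as a function sending each set to its partner. -/
structure IsLevelMatching (P : Finset (Finset α)) (j : ℕ) (M : Finset α → Finset α) : Prop where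
  mapsTo : Set.MapsTo M (P # j) (P # (j + 1))
  injOn : Set.InjOn M (P # j)
  subset : ∀ s ∈ P # j, s ⊆ M s

variable [DecidableEq α]

/-- The vertices of the link of `s` in the simplicial complex `P`: the elements outside `s` whose
addition to `s` stays in `P`. -/
def linkVertices (P : Finset (Finset α)) (s : Finset α) : Finset α :=
  {y ∈ P.sup id \ s | insert y s ∈ P}

lemma mem_linkVertices {y : α} : y ∈ linkVertices P s ↔ y ∉ s ∧ insert y s ∈ P := by
  simp only [linkVertices, mem_filter, mem_sdiff, mem_sup, id]
  exact ⟨fun h => ⟨h.1.2, h.2⟩, fun h => ⟨⟨⟨_, h.2, mem_insert_self y s⟩, h.1⟩, h.2⟩⟩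

lemma linkVertices_anti (hP : IsLowerSet (P : Set (Finset α))) :
    Antitone (linkVertices P) := fun s t hst y hy => by
  rw [mem_linkVertices] at hy ⊢
  exact ⟨fun hys => hy.1 (hst hys), hP (insert_subset_insert y hst) hy.2⟩

-- The pairs `s ⊂ s ∪ {y}` are sent injectively to the pairs `M (s ∪ {y}) \ {y} ⊂ M (s ∪ {y})`.
lemma IsLevelMatching.card_le_card_of_succ (hP : IsLowerSet (P : Set (Finset α)))
    {M : Finset α → Finset α} (hM : IsLevelMatching P (j + 1) M)
    (hlink : ∀ s ∈ P # j, (linkVertices P s).Nonempty) {U : Finset (Finset α)} (hU : U ⊆ P # j) :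
    #U ≤ #{t ∈ P # (j + 1) | ∃ s ∈ U, s ⊆ t} := by
  have hins {s : Finset α} {y : α} (hs : s ∈ U) (hy : y ∈ linkVertices P s) :
      y ∉ s ∧ insert y s ∈ P # (j + 1) := by
    obtain ⟨hys, hins⟩ := mem_linkVertices.1 hy
    exact ⟨hys, mem_slice.2 ⟨hins, by rw [card_insert_of_notMem hys, (mem_slice.1 (hU hs)).2]⟩⟩
  have hmem {s : Finset α} {y : α} (hs : s ∈ U) (hy : y ∈ linkVertices P s) :
      y ∈ M (insert y s) := hM.subset _ (hins hs hy).2 (mem_insert_self y s)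
  have hsub {s : Finset α} {y : α} (hs : s ∈ U) (hy : y ∈ linkVertices P s) :
      s ⊆ (M (insert y s)).erase y :=
    subset_erase.2 ⟨(subset_insert y s).trans (hM.subset _ (hins hs hy).2), (hins hs hy).1⟩
  refine card_le_card_of_injOn_sigma (L := linkVertices P) (L' := linkVertices P)
    (fun s hs => hlink s (hU hs)) (fun p => ⟨(M (insert p.2 p.1)).erase p.2, p.2⟩) ?_ ?_ ?_
  · rintro ⟨s, y⟩ hp
    obtain ⟨hs, hy⟩ := mem_sigma.1 hp
    obtain ⟨hMP, hMcard⟩ := mem_slice.1 (hM.mapsTo (hins hs hy).2)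
    have hcard : #((M (insert y s)).erase y) = j + 1 := by
      rw [card_erase_of_mem (hmem hs hy), hMcard, Nat.add_sub_cancel]
    refine mem_sigma.2 ⟨mem_filter.2 ⟨mem_slice.2 ⟨hP (erase_subset _ _) hMP, hcard⟩,
      s, hs, hsub hs hy⟩, mem_linkVertices.2 ⟨notMem_erase _ _, ?_⟩⟩
    rwa [insert_erase (hmem hs hy)]
  · rintro ⟨s, y⟩ hp ⟨s', y'⟩ hp' heq
    obtain ⟨hs, hy⟩ := mem_sigma.1 hp
    obtain ⟨hs', hy'⟩ := mem_sigma.1 hp'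
    obtain ⟨herase, hyy'⟩ := Sigma.mk.inj_iff.1 heq
    obtain rfl : y = y' := eq_of_heq hyy'
    have hMM : M (insert y s) = M (insert y s') := by
      rw [← insert_erase (hmem hs hy), ← insert_erase (hmem hs' hy'), herase]
    have hss' := hM.injOn (hins hs hy).2 (hins hs' hy').2 hMM
    have : s = s' := by
      calc s = (insert y s).erase y := (erase_insert (hins hs hy).1).symm
        _ = (insert y s').erase y := by rw [hss']
        _ = s' := erase_insert (hins hs' hy').1
    rw [this]
  · rintro ⟨s, y⟩ hp
    obtain ⟨hs, hy⟩ := mem_sigma.1 hp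
    exact card_le_card (linkVertices_anti hP (hsub hs hy))

lemma IsLevelMatching.exists_of_succ (hP : IsLowerSet (P : Set (Finset α)))
    {M : Finset α → Finset α} (hM : IsLevelMatching P (j + 1) M)
    (hlink : ∀ s ∈ P # j, (linkVertices P s).Nonempty) : ∃ M', IsLevelMatching P j M' := by
  obtain ⟨f, hinj, hf⟩ := (all_card_le_biUnion_card_iff_exists_injective
    fun s : P # j => {t ∈ P # (j + 1) | s.1 ⊆ t}).1 fun U => by
      have hU : U.map (.subtype _) ⊆ P # j := fun s hs => by
        obtain ⟨s, -, rfl⟩ := mem_map.1 hs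
        exact s.2
      rw [← card_map (.subtype _)]
      refine (hM.card_le_card_of_succ hP hlink hU).trans (card_le_card fun t ht => ?_)
      obtain ⟨htP, s, hs, hst⟩ := mem_filter.1 ht
      obtain ⟨s, hsU, rfl⟩ := mem_map.1 hs
      exact mem_biUnion.2 ⟨s, hsU, mem_filter.2 ⟨htP, hst⟩⟩
  have hext : ∀ s (hs : s ∈ P # j), Subtype.val.extend f id s = f ⟨s, hs⟩ := fun s hs =>
    Subtype.val_injective.extend_apply f id ⟨s, hs⟩
  refine ⟨Subtype.val.extend f id, fun s hs => ?_, fun s hs t ht hst => ?_, fun s hs => ?_⟩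
  · rw [hext s hs]
    exact (mem_filter.1 (hf ⟨s, hs⟩)).1
  · rw [hext s hs, hext t ht] at hst
    exact congrArg Subtype.val (hinj hst)
  · rw [hext s hs]
    exact (mem_filter.1 (hf ⟨s, hs⟩)).2

lemma IsLevelMatching.exists_of_le (hP : IsLowerSet (P : Set (Finset α)))
    {M : Finset α → Finset α} (hM : IsLevelMatching P m M)
    (hlink : ∀ s ∈ P, #s < m → (linkVertices P s).Nonempty) (hj : j ≤ m) :
    ∃ M', IsLevelMatching P j M' := by
  induction hj using Nat.decreasingInduction with
  | self => exact ⟨M, hM⟩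
  | of_succ i hi ih =>
    obtain ⟨M', hM'⟩ := ih
    exact hM'.exists_of_succ hP fun s hs =>
      hlink s (mem_slice.1 hs).1 ((mem_slice.1 hs).2.trans_lt hi)

end LevelMatching

section PushUp

open Finset
open scoped FinsetFamily

lemma isAntichain_sep_union_sep {β : Type*} [Preorder β] {T B : Set β}
    (hT : IsAntichain (· ≤ ·) T) (hB : IsAntichain (· ≤ ·) B) :
    IsAntichain (· ≤ ·) ({t ∈ T | ¬ ∃ b ∈ B, t ≤ b} ∪ {b ∈ B | ∃ t ∈ T, t ≤ b}) := by
  rintro x (⟨hxT, hxB⟩ | ⟨hxB, hxT⟩) y (⟨hyT, hyB⟩ | ⟨hyB, _⟩) hxy hle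
  · exact hT hxT hyT hxy hle
  · exact hxB ⟨y, hyB, hle⟩
  · obtain ⟨t, ht, htx⟩ := hxT
    obtain rfl := hT.eq ht hyT (htx.trans hle)
    exact hyB ⟨x, hxB, htx⟩
  · exact hB hxB hyB hxy hle

variable {α : Type*} {P B T : Finset (Finset α)} {Y : Finset α} {j m r : ℕ}

lemma IsLevelMatching.isChainColoring_piecewise {M top : Finset α → Finset α}
    (hM : IsLevelMatching P j M) (hcol : IsChainColoring {s | s ∈ P ∧ j < #s} top) :
    IsChainColoring {s | s ∈ P ∧ j ≤ #s} ({s | j < #s}.piecewise top (top ∘ M)) := by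
  have hslice : ∀ s ∈ {s | s ∈ P ∧ j ≤ #s} \ {s | j < #s}, s ∈ P # j := fun s hs =>
    mem_slice.2 ⟨hs.1.1, (not_lt.1 hs.2).antisymm hs.1.2⟩
  have hMj : ∀ s ∈ P # j, M s ∈ P ∧ #(M s) = j + 1 := fun s hs => mem_slice.1 (hM.mapsTo hs)
  have hMX : ∀ s ∈ P # j, M s ∈ {s | s ∈ P ∧ j < #s} := fun s hs =>
    ⟨(hMj s hs).1, by grind⟩
  refine .piecewise (hcol.mono fun s hs => ⟨hs.1.1, hs.2⟩) (fun s hs t ht hst => ?_)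
    fun s hs t ht hst => ?_
  · have hs' := hslice s hs
    have ht' := hslice t ht
    have hcard : #(M s) = #(M t) := (hMj s hs').2.trans (hMj t ht').2.symm
    have hMst : M s = M t :=
      (hcol.subset_of_card_le (hMX s hs') (hMX t ht') hst hcard.le).antisymm
        (hcol.subset_of_card_le (hMX t ht') (hMX s hs') hst.symm hcard.ge)
    exact .inl (hM.injOn hs' ht' hMst).le
  · have ht' := hslice t ht
    calc t ⊆ M t := hM.subset t ht'
      _ ⊆ s := hcol.subset_of_card_le (hMX t ht') ⟨hs.1.1, hs.2⟩ hst ((hMj t ht').2.trans_le hs.2)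

lemma exists_isChainColoring_top (hPr : ∀ s ∈ P, #s ≤ r)
    (hM : ∀ j < r, ∃ M, IsLevelMatching P j M ∧ ∀ s ∈ P # j, M s ≠ Y) :
    ∃ top : Finset α → Finset α, IsChainColoring (P : Set (Finset α)) top ∧
      ∀ s ∈ P, s ⊆ top s ∧ top s ∈ P # r ∧ (top s = Y → s = Y) := by
  suffices H : ∀ j ≤ r, ∃ top : Finset α → Finset α,
      IsChainColoring {s | s ∈ P ∧ j ≤ #s} top ∧
      ∀ s ∈ P, j ≤ #s → s ⊆ top s ∧ top s ∈ P # r ∧ (top s = Y → s = Y) by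
    simpa using H 0 r.zero_le
  intro j hj
  induction hj using Nat.decreasingInduction with
  | self =>
    refine ⟨id, fun s _ t _ hst => .inl hst.le, fun s hs hr => ⟨subset_rfl, ?_, id⟩⟩
    exact mem_slice.2 ⟨hs, (hPr s hs).antisymm hr⟩
  | of_succ j hj ih =>
    obtain ⟨top, hcol, htop⟩ := ih
    obtain ⟨M, hM, hMY⟩ := hM j hj
    refine ⟨_, hM.isChainColoring_piecewise hcol, fun s hs hjs => ?_⟩
    by_cases hlt : j < #s
    · simpa [hlt] using htop s hs hlt
    · have hsj : s ∈ P # j := mem_slice.2 ⟨hs, (not_lt.1 hlt).antisymm hjs⟩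
      obtain ⟨hMP, hMcard⟩ := mem_slice.1 (hM.mapsTo hsj)
      obtain ⟨hsub, hmem, hY⟩ := htop (M s) hMP hMcard.ge
      rw [Set.piecewise_eq_of_notMem {s | j < #s} _ _ hlt]
      exact ⟨(hM.subset s hsj).trans hsub, hmem, fun h => (hMY s hsj (hY h)).elim⟩

variable [DecidableEq α]

lemma exists_isChainColoring_top_of_shadow (hB : (B : Set (Finset α)).Sized (m + 1)) (hY : Y ∈ B)
    {M : Finset α → Finset α} (hM : Set.MapsTo M (∂ B) (B.erase Y)) (hinj : Set.InjOn M (∂ B))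
    (hsub : ∀ a ∈ ∂ B, a ⊆ M a) :
    ∃ top : Finset α → Finset α, IsChainColoring {s | ∃ b ∈ B, s ⊆ b} top ∧
      ∀ s, (∃ b ∈ B, s ⊆ b) → s ⊆ top s ∧ top s ∈ B ∧ (top s = Y → s = Y) := by
  set P := B.biUnion powerset
  have mem_P : ∀ {s}, s ∈ P ↔ ∃ b ∈ B, s ⊆ b := by simp [P]
  have hP : IsLowerSet (P : Set (Finset α)) := fun s t hts hs => by
    obtain ⟨b, hb, hsb⟩ := mem_P.1 hs
    exact mem_P.2 ⟨b, hb, hts.trans hsb⟩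
  have hPcard : ∀ s ∈ P, #s ≤ m + 1 := fun s hs => by
    obtain ⟨b, hb, hsb⟩ := mem_P.1 hs
    exact hB hb ▸ card_le_card hsb
  have hPtop : P # (m + 1) ⊆ B := fun s hs => by
    obtain ⟨hsP, hcard⟩ := mem_slice.1 hs
    obtain ⟨b, hb, hsb⟩ := mem_P.1 hsP
    rwa [eq_of_subset_of_card_le hsb (by rw [hB hb, hcard])]
  have hPm : P # m ⊆ ∂ B := fun s hs => by
    obtain ⟨hsP, hcard⟩ := mem_slice.1 hs
    obtain ⟨b, hb, hsb⟩ := mem_P.1 hsP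
    exact mem_shadow_iff_exists_mem_card_add_one.2 ⟨b, hb, hsb, by rw [hB hb, hcard]⟩
  have hlink : ∀ s ∈ P, #s < m → (linkVertices P s).Nonempty := fun s hs hlt => by
    obtain ⟨b, hb, hsb⟩ := mem_P.1 hs
    obtain ⟨y, hyb, hys⟩ := exists_mem_notMem_of_card_lt_card (s := s) (t := b) (by grind [hB hb])
    exact ⟨y, mem_linkVertices.2 ⟨hys, mem_P.2 ⟨b, hb, insert_subset hyb hsb⟩⟩⟩
  have hMm : IsLevelMatching P m M := by
    refine ⟨fun a ha => ?_, hinj.mono hPm, fun a ha => hsub a (hPm ha)⟩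
    have hMB : M a ∈ B := mem_of_mem_erase (hM (hPm ha))
    exact mem_slice.2 ⟨mem_P.2 ⟨_, hMB, subset_rfl⟩, hB hMB⟩
  have hmatch : ∀ j < m + 1, ∃ M', IsLevelMatching P j M' ∧ ∀ s ∈ P # j, M' s ≠ Y := fun j hj => by
    obtain rfl | hjm := (Nat.lt_succ_iff.1 hj).eq_or_lt
    · exact ⟨M, hMm, fun s hs => ne_of_mem_erase (hM (hPm hs))⟩
    · obtain ⟨M', hM'⟩ := hMm.exists_of_le hP hlink hjm.le
      refine ⟨M', hM', fun s hs h => ?_⟩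
      have : #(M' s) = j + 1 := (mem_slice.1 (hM'.mapsTo hs)).2
      grind [hB hY]
  obtain ⟨top, hcol, htop⟩ := exists_isChainColoring_top hPcard hmatch
  refine ⟨top, hcol.mono fun s hs => mem_P.2 hs, fun s hs => ?_⟩
  obtain ⟨hsub, hmem, hY⟩ := htop s (mem_P.2 hs)
  exact ⟨hsub, hPtop hmem, hY⟩

lemma exists_isAntichain_card_lt (hB : (B : Set (Finset α)).Sized (m + 1)) (hY : Y ∈ B)
    {M : Finset α → Finset α} (hM : Set.MapsTo M (∂ B) (B.erase Y)) (hinj : Set.InjOn M (∂ B))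
    (hsub : ∀ a ∈ ∂ B, a ⊆ M a) (hT : IsAntichain (· ≤ ·) (T : Set (Finset α)))
    (hTY : ∃ t ∈ T, t ⊂ Y) :
    ∃ T' ⊆ T ∪ B, IsAntichain (· ≤ ·) (T' : Set (Finset α)) ∧ #T < #T' := by
  obtain ⟨top, hcol, htop⟩ := exists_isChainColoring_top_of_shadow hB hY hM hinj hsub
  have hYT : Y ∉ T := fun h => by
    obtain ⟨t, ht, htY⟩ := hTY
    exact hT ht h htY.ne htY.subset
  have hlt : #{t ∈ T | ∃ b ∈ B, t ⊆ b} < #{b ∈ B | ∃ t ∈ T, t ⊆ b} := by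
    calc #{t ∈ T | ∃ b ∈ B, t ⊆ b} ≤ #({b ∈ B | ∃ t ∈ T, t ⊆ b}.erase Y) := by
          refine card_le_card_of_injOn top (fun t ht => ?_) ?_
          · obtain ⟨htT, htB⟩ := mem_filter.1 ht
            obtain ⟨hsub, hmem, hY⟩ := htop t htB
            exact mem_erase.2 ⟨fun h => hYT (hY h ▸ htT), mem_filter.2 ⟨hmem, t, htT, hsub⟩⟩
          · exact hcol.injOn_of_isAntichain (fun t ht => (mem_filter.1 ht).2)
              (hT.subset fun t ht => (mem_filter.1 ht).1)
      _ < #{b ∈ B | ∃ t ∈ T, t ⊆ b} := card_erase_lt_of_mem <| mem_filter.2 <|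
          ⟨hY, hTY.imp fun t ht => ⟨ht.1, ht.2.subset⟩⟩
  have hdisj : Disjoint {t ∈ T | ¬ ∃ b ∈ B, t ⊆ b} {b ∈ B | ∃ t ∈ T, t ⊆ b} :=
    disjoint_left.2 fun b hbT hbB =>
      (mem_filter.1 hbT).2 ⟨b, (mem_filter.1 hbB).1, subset_rfl⟩
  refine ⟨{t ∈ T | ¬ ∃ b ∈ B, t ⊆ b} ∪ {b ∈ B | ∃ t ∈ T, t ⊆ b},
    union_subset_union (filter_subset _ _) (filter_subset _ _), ?_, ?_⟩
  · simpa using isAntichain_sep_union_sep hT hB.isAntichain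
  · rw [card_union_of_disjoint hdisj,
      ← card_filter_add_card_filter_not (s := T) fun t => ∃ b ∈ B, t ⊆ b]
    lia

end PushUp

section AlternatingPath

open SimpleGraph

variable {α : Type*} {G M : SimpleGraph α} {x x' y z b : α}

/-- A path of odd length in `G` in which every second edge, starting with the second one, belongs
to the matching `M`: an augmenting path without the condition on its end. -/
def IsAlternatingPath (M : SimpleGraph α) (p : G.Walk y z) : Prop :=
  p.IsPath ∧ Odd p.length ∧
    ∀ i : ℕ, 2 * i + 2 ≤ p.length → M.Adj (p.getVert (2 * i + 1)) (p.getVert (2 * i + 2))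

/-- The vertices to which an alternating path leads from `y`. -/
def alternatingReach (G M : SimpleGraph α) (y : α) : Set α :=
  {z | ∃ p : G.Walk y z, IsAlternatingPath M p}

lemma mem_alternatingReach_of_adj (h : G.Adj y z) : z ∈ alternatingReach G M y :=
  ⟨.cons h .nil, by simp [h.ne], by simp, fun i hi => by simp at hi⟩

lemma IsAlternatingPath.take {p : G.Walk y z} (hp : IsAlternatingPath M p) {i : ℕ}
    (hi : i ≤ p.length) (hodd : Odd i) : IsAlternatingPath M (p.take i) := by
  have hl : (p.take i).length = i := by rw [p.take_length, min_eq_left hi]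
  refine ⟨hp.1.take i, hl.symm ▸ hodd, fun j hj => ?_⟩
  rw [hl] at hj
  rw [p.take_getVert, p.take_getVert, min_eq_right (by lia), min_eq_right hj]
  exact hp.2.2 j (hj.trans hi)

lemma getVert_concat_of_le (p : G.Walk y x) (h : G.Adj x z) {i : ℕ} (hi : i ≤ p.length) :
    (p.concat h).getVert i = p.getVert i := by
  rw [Walk.concat, Walk.getVert_append', if_pos hi]

lemma IsAlternatingPath.concat_concat {p : G.Walk y x} (hp : IsAlternatingPath M p)
    (hxb : G.Adj x b) (hM : M.Adj x b) (hbx : G.Adj b x') (hb : b ∉ p.support)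
    (hx' : x' ∉ p.support) : IsAlternatingPath M ((p.concat hxb).concat hbx) := by
  have hlen : (p.concat hxb).length = p.length + 1 := p.length_concat hxb
  refine ⟨(hp.1.concat hb hxb).concat ?_ hbx, ?_, fun i hi => ?_⟩
  · simp [Walk.support_concat, hx', hbx.ne']
  · rw [Walk.length_concat, hlen]
    exact hp.2.1.add_even even_two
  · rw [Walk.length_concat, hlen] at hi
    obtain ⟨r, hr⟩ := hp.2.1
    rw [getVert_concat_of_le _ _ (by lia), getVert_concat_of_le _ _ (by lia),
      getVert_concat_of_le _ _ (by lia)]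
    obtain hir | rfl : i < r ∨ i = r := by lia
    · rw [getVert_concat_of_le _ _ (by lia)]
      exact hp.2.2 i (by lia)
    · rwa [show 2 * i + 2 = (p.concat hxb).length by lia, Walk.getVert_length, ← hr,
        Walk.getVert_length]

lemma odd_iff_coloring_getVert_ne (c : G.Coloring Bool) (p : G.Walk y z) {i : ℕ}
    (hi : i ≤ p.length) : Odd i ↔ c y ≠ c (p.getVert i) := by
  have h := c.odd_length_iff_not_congr (p.take i)
  rw [p.take_length, min_eq_left hi] at h
  rw [h]
  grind

lemma mem_alternatingReach_of_adj_of_adj (c : G.Coloring Bool) (hMG : M ≤ G)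
    (hM : ∀ b, (M.neighborSet b).Subsingleton) (hy : M.neighborSet y = ∅)
    (hx : x ∈ alternatingReach G M y) (hxb : M.Adj x b) (hbx : G.Adj b x') :
    x' ∈ alternatingReach G M y := by
  obtain ⟨p, hp⟩ := hx
  have hcx : c y ≠ c x := by
    simpa using (odd_iff_coloring_getVert_ne c p le_rfl).1 hp.2.1
  have hcb : c y = c b :=
    (Bool.eq_not.2 hcx).trans (Bool.eq_not.2 (c.valid (hMG hxb).symm)).symm
  have hcx' : c y ≠ c x' := hcb ▸ c.valid hbx
  by_cases hx' : x' ∈ p.support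
  · obtain ⟨i, rfl, hi⟩ := Walk.mem_support_iff_exists_getVert.1 hx'
    exact ⟨_, hp.take hi ((odd_iff_coloring_getVert_ne c p hi).2 hcx')⟩
  refine ⟨_, hp.concat_concat (hMG hxb) hxb hbx (fun hb => ?_) hx'⟩
  obtain ⟨i, rfl, hi⟩ := Walk.mem_support_iff_exists_getVert.1 hb
  have heven : ¬ Odd i := fun h => (odd_iff_coloring_getVert_ne c p hi).1 h hcb
  obtain rfl | ⟨j, rfl⟩ : i = 0 ∨ ∃ j, i = 2 * j + 2 := by
    obtain ⟨j, hj⟩ := Nat.not_odd_iff_even.1 heven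
    exact j.eq_zero_or_pos.imp (by lia) fun _ => ⟨j - 1, by lia⟩
  · rw [p.getVert_zero] at hxb
    exact Set.eq_empty_iff_forall_notMem.1 hy x hxb.symm
  · have hend : p.getVert (2 * j + 1) = x := hM _ (hp.2.2 j hi).symm hxb.symm
    have := (hp.1.getVert_eq_end_iff (by lia)).1 hend
    lia

end AlternatingPath

section Switching

open Finset

variable {α ι : Type*} {X : Set (Finset α)} {k r : ℕ}

/- The part of the chain of `u i` from level `k` upwards is moved onto the chain of `l i`. Its place
above `l i` is free, as the sets there lay on the chain of `u (i + 1)` and have been moved too. -/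
lemma IsChainColoring.exists_switch {col : Finset α → ι} (hcol : IsChainColoring X col)
    {u l : ℕ → Finset α} (hu : ∀ i ≤ r, u i ∈ X ∧ #(u i) = k)
    (hl : ∀ i ≤ r, l i ∈ X ∧ #(l i) + 1 = k) (hlu : ∀ i ≤ r, l i ⊂ u i)
    (hinj : Set.InjOn l {i | i ≤ r}) (hmatch : ∀ i < r, col (l i) = col (u (i + 1)))
    (hlast : ∀ x ∈ X, col x = col (l r) → x ⊆ l r) :
    ∃ col' : Finset α → ι, IsChainColoring X col' ∧
      Set.MapsTo col' X (col '' (X \ {u 0})) := by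
  classical
  set H : Set (Finset α) := {x | k ≤ #x ∧ ∃ i ≤ r, col x = col (u i)}
  choose! idx hidx using fun x (hx : x ∈ H) => hx.2
  have hl_ne : ∀ i ≤ r, l i ≠ u 0 := fun i hi h => by
    have := (hl i hi).2
    have := (hu 0 r.zero_le).2
    grind
  refine ⟨H.piecewise (fun x => col (l (idx x))) col, .piecewise ?_
    (hcol.mono Set.sdiff_subset) ?_, fun x hx => ?_⟩
  · intro a ha b hb hab
    obtain ⟨hai, ha'⟩ := hidx a ha.2
    obtain ⟨hbi, hb'⟩ := hidx b hb.2
    obtain ⟨hla, hlacard⟩ := hl _ hai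
    obtain ⟨hlb, hlbcard⟩ := hl _ hbi
    have hlab : l (idx a) = l (idx b) :=
      (hcol.subset_of_card_le hla hlb hab (by lia)).antisymm
        (hcol.subset_of_card_le hlb hla hab.symm (by lia))
    exact hcol a ha.1 b hb.1 (by rw [ha', hb', hinj hai hbi hlab])
  · rintro a ⟨haX, haH⟩ b ⟨hbX, hbH⟩ hba
    obtain ⟨hi, hai⟩ := hidx a haH
    set i := idx a
    obtain ⟨hlX, hlcard⟩ := hl i hi
    have hbk : #b < k := by
      by_contra! hkb
      obtain hir | hir := hi.lt_or_eq
      · exact hbH ⟨hkb, i + 1, hir, hba.trans (hmatch i hir)⟩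
      · have := card_le_card (hlast b hbX (hir ▸ hba))
        rw [hir] at hlcard
        lia
    calc b ⊆ l i := hcol.subset_of_card_le hbX hlX hba (by lia)
      _ ⊆ u i := (hlu i hi).subset
      _ ⊆ a := hcol.subset_of_card_le (hu i hi).1 haX hai.symm ((hu i hi).2.trans_le haH.1)
  · by_cases hxH : x ∈ H
    · obtain ⟨hi, -⟩ := hidx x hxH
      rw [Set.piecewise_eq_of_mem _ _ _ hxH]
      exact ⟨_, ⟨(hl _ hi).1, hl_ne _ hi⟩, rfl⟩
    · rw [Set.piecewise_eq_of_notMem _ _ _ hxH]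
      refine ⟨x, ⟨hx, ?_⟩, rfl⟩
      rintro rfl
      exact hxH ⟨(hu 0 r.zero_le).2.ge, 0, r.zero_le, rfl⟩

end Switching

section ChainPartition

lemma CoversIn.covBy {α : Type*} [PartialOrder α] {X : Finset α} (hX : IsLowerSet (X : Set α))
    {x y : α} (h : CoversIn X x y) : x ⋖ y := by
  obtain ⟨-, hy, hxy, hbetween⟩ := h
  refine ⟨hxy, fun z hxz hzy => ?_⟩
  rcases hbetween z (hX hzy.le hy) hxz.le hzy.le with rfl | rfl
  · exact hxz.false
  · exact hzy.false

variable {α : Type*} [DecidableEq α] {X : Finset α} {C : Finpartition X} {G : SimpleGraph α}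

lemma chainMatching_le : chainMatching C G ≤ G := fun _ _ h => h.1

lemma chainMatching_adj_iff {a b : α} :
    (chainMatching C G).Adj a b ↔ G.Adj a b ∧ a ∈ C.part b :=
  and_congr_right fun _ => C.mem_part_iff_exists.symm

lemma mem_of_chainMatching_adj {a b : α} (h : (chainMatching C G).Adj a b) : b ∈ X :=
  have ⟨_, _, hc, _, hbc⟩ := h
  C.le hc hbc

lemma part_eq_of_chainMatching_adj {a b : α} (h : (chainMatching C G).Adj a b) :
    C.part a = C.part b :=
  (C.mem_part_iff_part_eq_part (mem_of_chainMatching_adj h.symm) (mem_of_chainMatching_adj h)).1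
    (chainMatching_adj_iff.1 h).2

variable [PartialOrder α]

lemma exists_coversIn_of_not_isGreatest (hC : ∀ c ∈ C.parts, IsSkiplessChain X c) {x : α}
    (hx : x ∈ X) (hmax : ¬ ∃ c ∈ C.parts, IsGreatest (c : Set α) x) :
    ∃ y ∈ C.part x, CoversIn X x y := by
  classical
  have hc : C.part x ∈ C.parts := C.part_mem.2 hx
  have hxc : x ∈ C.part x := C.mem_part hx
  obtain ⟨-, hchain, hskipless⟩ := hC _ hc
  obtain ⟨w, hw, hwx⟩ : ∃ w ∈ C.part x, ¬ w ≤ x := by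
    by_contra! h
    exact hmax ⟨_, hc, hxc, h⟩
  have hxw : x < w := lt_of_le_not_ge ((hchain.total hxc hw).resolve_right hwx) hwx
  obtain ⟨y, -, hy⟩ := ((C.part x).filter (x < ·)).exists_le_minimal
    (Finset.mem_filter.2 ⟨hw, hxw⟩)
  obtain ⟨hyc, hxy⟩ := Finset.mem_filter.1 hy.prop
  refine ⟨y, hyc, hskipless x y ⟨hxc, hyc, hxy, fun z hz hxz hzy => ?_⟩⟩
  exact hxz.eq_or_lt.imp Eq.symm fun hxz => hy.eq_of_le (Finset.mem_filter.2 ⟨hz, hxz⟩) hzy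

end ChainPartition

section LevelGraph

open Finset

variable {n : ℕ} {F : Finset (Finset (Fin n))} {k : ℕ} {A B Y Z : Finset (Fin n)}

lemma levelGraph_adj_of_card_add_one_eq (h : (levelGraph F k).Adj A B) (hA : #A + 1 = k) :
    #B = k ∧ A ⊂ B := by
  rcases h.2.2 with h' | h'
  · exact ⟨h'.2.1, h'.2.2⟩
  · lia

/-- The bipartition of `levelGraph F k`, as a colouring telling whether a set has size `k`. -/
def levelGraphColoring (F : Finset (Finset (Fin n))) (k : ℕ) : (levelGraph F k).Coloring Bool :=
  .mk (fun A => #A = k) fun {A B} h => by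
    have := h.2.2
    simp only [ne_eq, decide_eq_decide]
    lia

lemma levelGraphColoring_eq_true_iff : levelGraphColoring F k A = true ↔ #A = k :=
  decide_eq_true_iff

lemma card_of_odd_length (hY : #Y = k) {p : (levelGraph F k).Walk Y Z} (hp : Odd p.length) :
    #Z + 1 = k := by
  have hZ : #Z ≠ k := by
    have h := ((levelGraphColoring F k).odd_length_iff_not_congr p).1 hp
    rw [levelGraphColoring_eq_true_iff, levelGraphColoring_eq_true_iff] at h
    exact fun hZ => h.2 hZ hY
  have hnil : ¬ p.Nil := fun h => by
    simp [SimpleGraph.Walk.length_eq_zero_iff.2 h] at hp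
  have := (p.adj_penultimate hnil).2.2
  lia

lemma card_getVert_of_odd (hY : #Y = k) (p : (levelGraph F k).Walk Y Z) {i : ℕ}
    (hi : i ≤ p.length) (hodd : Odd i) : #(p.getVert i) + 1 = k :=
  card_of_odd_length hY (p := p.take i) (by rwa [p.take_length, min_eq_left hi])

variable {D : Finset (Finset (Fin n))} {C : Finpartition D}

lemma chainMatching_levelGraph_subsingleton_neighborSet
    (hC : ∀ c ∈ C.parts, IsChain (· ≤ ·) (c : Set (Finset (Fin n)))) (B : Finset (Fin n)) :
    ((chainMatching C (levelGraph F k)).neighborSet B).Subsingleton := fun A hA A' hA' => by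
  have hcard : #A = #A' := by
    have := hA.1.2.2
    have := hA'.1.2.2
    lia
  have hchain := hC _ (C.part_mem.2 (mem_of_chainMatching_adj hA.symm))
  rcases hchain.total (chainMatching_adj_iff.1 hA.symm).2 (chainMatching_adj_iff.1 hA'.symm).2
    with h | h
  · exact eq_of_subset_of_card_le h hcard.ge
  · exact (eq_of_subset_of_card_le h hcard.le).symm

lemma exists_chainMatching_levelGraph_adj (hD : IsLowerSet (D : Set (Finset (Fin n))))
    (hC : ∀ c ∈ C.parts, IsSkiplessChain D c) (hDF : D ⊆ F) (hA : A ∈ D) (hAk : #A + 1 = k)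
    (hmax : ¬ ∃ c ∈ C.parts, IsGreatest (c : Set (Finset (Fin n))) A) :
    ∃ B, (chainMatching C (levelGraph F k)).Adj A B := by
  obtain ⟨B, hBA, hAB⟩ := exists_coversIn_of_not_isGreatest hC hA hmax
  have hBk : #B = k := by
    rw [← hAk, Nat.covBy_iff_add_one_eq.1 (hAB.covBy hD).card_finset]
  have hadj : (levelGraph F k).Adj B A :=
    ⟨hDF hAB.2.1, hDF hA, .inr ⟨hAk, hBk, hAB.2.2.1⟩⟩
  exact ⟨B, (chainMatching_adj_iff.2 ⟨hadj, hBA⟩).symm⟩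

end LevelGraph

section AugmentingPath

open Finset
open scoped FinsetFamily

variable {n : ℕ} {D : Finset (Finset (Fin n))} {C : Finpartition D} {k : ℕ} {Y Z : Finset (Fin n)}

lemma IsAugmentingPath.width_insert_le (hC : IsSDPartition C) (hk : #Y = k)
    {p : (levelGraph (insert Y D) k).Walk Y Z} (hp : IsAugmentingPath C p) :
    width (insert Y D) ≤ width D := by
  obtain ⟨hpath, ⟨r, hr⟩, hmatch, c, hc, hZ⟩ := hp
  have hadj : ∀ i ≤ r,
      (levelGraph (insert Y D) k).Adj (p.getVert (2 * i + 1)) (p.getVert (2 * i)) :=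
    fun i hi => (p.adj_getVert_succ (by lia)).symm
  have hl : ∀ i ≤ r, #(p.getVert (2 * i + 1)) + 1 = k := fun i hi =>
    card_getVert_of_odd hk p (by lia) (odd_two_mul_add_one i)
  have hu : ∀ i ≤ r, #(p.getVert (2 * i)) = k ∧ p.getVert (2 * i + 1) ⊂ p.getVert (2 * i) :=
    fun i hi => levelGraph_adj_of_card_add_one_eq (hadj i hi) (hl i hi)
  have hpart := isChainColoring_insert_part (fun c hc => (hC.1 c hc).2.1) Y
  obtain ⟨col, hcol, hmaps⟩ := hpart.exists_switch
    (k := k) (r := r) (u := fun i => p.getVert (2 * i)) (l := fun i => p.getVert (2 * i + 1))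
    (fun i hi => ⟨mod_cast (hadj i hi).2.1, (hu i hi).1⟩)
    (fun i hi => ⟨mod_cast (hadj i hi).1, hl i hi⟩) (fun i hi => (hu i hi).2)
    (fun i hi j hj hij => by
      have := hpath.getVert_injOn (by grind) (by grind) hij
      lia)
    (fun i hi => part_eq_of_chainMatching_adj (hmatch i (by lia)))
    (fun x _ hxZ => by
      rw [← hr, p.getVert_length] at hxZ ⊢
      rw [C.part_eq_of_mem hc hZ.1] at hxZ
      exact hZ.2 ((C.part_eq_iff_mem hc).1 hxZ))
  rw [← hC.2]
  refine IsChainColoring.width_le (col := col) (by rwa [coe_insert]) fun x hx => ?_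
  obtain ⟨z, ⟨hz, hzY⟩, hzx⟩ := hmaps (by simpa using hx)
  rw [p.getVert_zero] at hzY
  exact hzx ▸ C.part_mem.2 (hz.resolve_left hzY)

lemma mem_alternatingReach_of_mem_shadow {F B : Finset (Finset (Fin n))}
    (hF : IsLowerSet (F : Set (Finset (Fin n))))
    (hC : ∀ c ∈ C.parts, IsChain (· ≤ ·) (c : Set (Finset (Fin n)))) (hY : Y ∉ D)
    (hBF : B ⊆ F) (hBk : (B : Set (Finset (Fin n))).Sized k)
    (hB : ∀ b ∈ B, b = Y ∨
      ∃ x ∈ alternatingReach (levelGraph F k) (chainMatching C (levelGraph F k)) Y,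
        (chainMatching C (levelGraph F k)).Adj x b) {a : Finset (Fin n)} (ha : a ∈ ∂ B) :
    a ∈ alternatingReach (levelGraph F k) (chainMatching C (levelGraph F k)) Y := by
  obtain ⟨b, hb, hab, hcard⟩ := mem_shadow_iff_exists_mem_card_add_one.1 ha
  have hadj : (levelGraph F k).Adj b a :=
    ⟨hBF hb, hF hab (hBF hb), .inr ⟨hcard ▸ hBk hb, hBk hb, hab.ssubset_of_ne fun h => by grind⟩⟩
  rcases hB b hb with rfl | ⟨x, hx, hxb⟩
  · exact mem_alternatingReach_of_adj hadj
  · refine mem_alternatingReach_of_adj_of_adj (levelGraphColoring F k) chainMatching_le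
      (chainMatching_levelGraph_subsingleton_neighborSet hC) ?_ hx hxb hadj
    exact Set.eq_empty_of_forall_notMem fun a ha => hY (mem_of_chainMatching_adj ha.symm)

lemma exists_shadow_matching (hD : IsLowerSet (D : Set (Finset (Fin n)))) (hC : IsSDPartition C)
    (hY : Y ∉ D) (hk : #Y = k)
    (hD' : IsLowerSet ((insert Y D : Finset (Finset (Fin n))) : Set (Finset (Fin n))))
    (hno : ∀ Z (p : (levelGraph (insert Y D) k).Walk Y Z), ¬ IsAugmentingPath C p) :
    ∃ B ⊆ insert Y D, Y ∈ B ∧ (B : Set (Finset (Fin n))).Sized k ∧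
      ∃ M : Finset (Fin n) → Finset (Fin n), Set.MapsTo M (∂ B) (B.erase Y) ∧
        Set.InjOn M (∂ B) ∧ ∀ a ∈ ∂ B, a ⊆ M a := by
  classical
  set G := levelGraph (insert Y D) k
  set R : Set (Finset (Fin n)) := alternatingReach G (chainMatching C G) Y
  set B : Finset (Finset (Fin n)) := insert Y {b ∈ D | ∃ a ∈ R, (chainMatching C G).Adj a b}
  have hchain : ∀ c ∈ C.parts, IsChain (· ≤ ·) (c : Set (Finset (Fin n))) :=
    fun c hc => (hC.1 c hc).2.1
  have hBD : B ⊆ insert Y D := insert_subset_insert Y (filter_subset _ D)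
  have hB : ∀ b ∈ B, b = Y ∨ ∃ a ∈ R, (chainMatching C G).Adj a b := fun b hb => by
    rcases mem_insert.1 hb with rfl | hb
    · exact .inl rfl
    · exact .inr (mem_filter.1 hb).2
  have hRcard : ∀ a ∈ R, #a + 1 = k := fun a ⟨p, hp⟩ => card_of_odd_length hk hp.2.1
  have hBk : (B : Set (Finset (Fin n))).Sized k := fun b hb => by
    rcases hB b hb with rfl | ⟨a, ha, hab⟩
    · exact hk
    · exact (levelGraph_adj_of_card_add_one_eq hab.1 (hRcard a ha)).1
  have hshadow : ∀ a ∈ ∂ B, a ∈ R := fun a =>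
    mem_alternatingReach_of_mem_shadow hD' hchain hY hBD hBk hB
  have hpartner : ∀ a ∈ ∂ B, ∃ b, (chainMatching C G).Adj a b := fun a ha => by
    have haD : a ∈ D := by
      obtain ⟨b, hb, hab, -⟩ := mem_shadow_iff_exists_mem_card_add_one.1 ha
      exact (mem_insert.1 (hD' hab (hBD hb))).resolve_left fun h => by grind
    obtain ⟨p, hp⟩ := hshadow a ha
    exact exists_chainMatching_levelGraph_adj hD hC.1 (subset_insert Y D) haD
      (hRcard a (hshadow a ha)) fun hmax => hno a p ⟨hp.1, hp.2.1, hp.2.2, hmax⟩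
  choose! M hM using hpartner
  refine ⟨B, hBD, mem_insert_self _ _, hBk, M, fun a ha => ?_, fun a ha a' ha' h => ?_,
    fun a ha => ?_⟩
  · have hMD : M a ∈ D := mem_of_chainMatching_adj (hM a ha)
    exact mem_erase.2 ⟨fun h => hY (h ▸ hMD), mem_insert_of_mem
      (mem_filter.2 ⟨hMD, a, hshadow a ha, hM a ha⟩)⟩
  · exact chainMatching_levelGraph_subsingleton_neighborSet hchain (M a)
      (hM a ha).symm (h ▸ (hM a' ha').symm)
  · exact (levelGraph_adj_of_card_add_one_eq (hM a ha).1 (hRcard a (hshadow a ha))).2.subset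

lemma width_lt_width_insert (hD : IsLowerSet (D : Set (Finset (Fin n)))) (hC : IsSDPartition C)
    (hY : Y ∉ D) (hk : #Y = k)
    (hD' : IsLowerSet ((insert Y D : Finset (Finset (Fin n))) : Set (Finset (Fin n))))
    (hno : ∀ Z (p : (levelGraph (insert Y D) k).Walk Y Z), ¬ IsAugmentingPath C p) :
    width D < width (insert Y D) := by
  obtain ⟨T, hTD, hT, hTw⟩ := exists_isAntichain_card_eq_width D
  rw [← hTw]
  by_cases hTY : ∃ t ∈ T, t ⊂ Y
  · obtain ⟨B, hBD, hYB, hB, M, hM, hinj, hsub⟩ := exists_shadow_matching hD hC hY hk hD' hno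
    obtain ⟨m, rfl⟩ : ∃ m, k = m + 1 := by
      obtain ⟨t, -, ht⟩ := hTY
      exact Nat.exists_eq_add_one.2 (hk ▸ (Nat.zero_le _).trans_lt (card_lt_card ht))
    obtain ⟨T', hT'sub, hT', hlt⟩ := exists_isAntichain_card_lt hB hYB hM hinj hsub hT hTY
    exact hlt.trans_le <| card_le_width
      (hT'sub.trans (union_subset (hTD.trans (subset_insert Y D)) hBD)) hT'
  · have hYT : IsAntichain (· ≤ ·) (insert Y T : Set (Finset (Fin n))) :=
      hT.insert (fun t ht hne hle => hTY ⟨t, ht, hle.lt_of_ne hne.symm⟩)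
        fun t ht _ hle => hY (hD hle (hTD ht))
    rw [← Nat.add_one_le_iff, ← card_insert_of_notMem fun h => hY (hTD h)]
    exact card_le_width (insert_subset_insert Y hTD) (by rwa [coe_insert])

end AugmentingPath

theorem proposition11 {n : ℕ} (D : Finset (Finset (Fin n)))
    (hD : IsLowerSet (D : Set (Finset (Fin n))))
    (C : Finpartition D) (hC : IsSDPartition C)
    (k : ℕ) (Y : Finset (Fin n)) (hY : Y ∉ D) (hk : Y.card = k)
    (hD' : IsLowerSet ((insert Y D : Finset (Finset (Fin n))) : Set (Finset (Fin n)))) :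
    width D = width (insert Y D) ↔
      ∃ (Z : Finset (Fin n)) (p : (levelGraph (insert Y D) k).Walk Y Z),
        IsAugmentingPath C p := by
  constructor
  · contrapose!
    exact fun hno => (width_lt_width_insert hD hC hY hk hD' hno).ne
  · rintro ⟨Z, p, hp⟩
    exact (width_mono (Finset.subset_insert Y D)).antisymm (hp.width_insert_le hC hk)
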